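/- Let $\mathbb{K}$ be $\mathbb{R}$ or $\mathbb{C}$. For $K\ge 1$, a Schauder basis $(b_n)_{n=1}^\infty$ of a Banach space is called $K$-unconditional if $\|\sum_n \pm a_n b_n\|\le K\|\sum_n a_n b_n\|$ for all choices of signs and all scalars $(a_n)$ for which $\sum_n a_nb_n$ converges, and $K$-symmetric if $\|\sum_n \pm a_{\sigma(n)} b_n\|\le K\|\sum_n a_n b_n\|$ for all such scalars, all choices of signs and all permutations $\sigma$ of $\mathbb{N}$ (the series on the left being required to converge). Let $F$ be a Banach space with a $1$-symmetric Schauder basis $(e_n)_{n=1}^\infty$, regarded as a space of scalar sequences through the coordinates with respect to $(e_n)$. Assume that $F\subseteq c_0$ with $\|x\|_\infty\le\|x\|_F$ for all $x\in F$, and that $$\lim_{n\to\infty}\frac{\|\sum_{i=1}^n e_i\|_{\infty}}{\|\sum_{i=1}^n e_i\|_F}=0 .$$ For a real number $m\ge 1$ and $x\in c_0$ put $$\|x\|_m=\inf\Big\{\big(\|y\|_\infty^2+\|z\|_F^2\big)^{1/2} : x=\tfrac1m y+mz,\ y\in c_0,\ z\in F\Big\}.$$ Let $X$ be a Banach space with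 a normalized $1$-unconditional Schauder basis $(f_n)_{n=1}^\infty$, and let $(m_n)_{n=1}^\infty$ be a strictly increasing sequence of real numbers $m_n\ge1$ with $\sum_{n=1}^\infty 1/m_n<\infty$. Let $Y=Y(c_0,F,X,(m_n)_{n=1}^\infty)$ be the space of all $x\in c_0$ for which the series $\sum_{n=1}^\infty\|x\|_{m_n}f_n$ converges in $X$, with the norm $$\|x\|_Y=\Big\|\sum_{n=1}^\infty\|x\|_{m_n}f_n\Big\|_X .$$ If $X$ is reflexive, then $Y$ is reflexive. -/

import Mathlib

open Filter Topology

open scoped ZeroAtInfty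

noncomputable section

namespace Davis

variable {𝕜 : Type*} [RCLike 𝕜]
variable {F : Type*} [NormedAddCommGroup F] [NormedSpace 𝕜 F]
variable {X : Type*} [NormedAddCommGroup X] [NormedSpace 𝕜 X]

/-- A normed space is reflexive if the canonical embedding into its bidual is onto. -/
def IsReflexive (𝕜 : Type*) [RCLike 𝕜] (V : Type*) [NormedAddCommGroup V] [NormedSpace 𝕜 V] :
    Prop :=
  Function.Surjective (NormedSpace.inclusionInDoubleDual 𝕜 V)

/-- Convergence of the series `∑ v n`, in the sense of its partial sums. -/
abbrev Converges (v : ℕ → X) : Prop := Summable v (SummationFilter.conditional ℕ)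

/-- The sum `lim_N ∑_{n < N} v n` of a series. -/
abbrev seriesSum (v : ℕ → X) : X := ∑'[SummationFilter.conditional ℕ] n, v n

/-- A choice of signs. -/
def IsSigns (ε : ℕ → 𝕜) : Prop := ∀ n, ε n = 1 ∨ ε n = -1

/-- A `K`-unconditional basis: `‖∑ ± aₙ eₙ‖ ≤ K ‖∑ aₙ eₙ‖`. -/
def IsUnconditional (K : ℝ) (e : SchauderBasis 𝕜 X) : Prop :=
  ∀ (a ε : ℕ → 𝕜), IsSigns ε → Converges (fun n => a n • e n) →
    Converges (fun n => (ε n * a n) • e n) ∧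
      ‖seriesSum (fun n => (ε n * a n) • e n)‖ ≤ K * ‖seriesSum (fun n => a n • e n)‖

/-- A `K`-symmetric basis: `‖∑ ± a_{σ(n)} eₙ‖ ≤ K ‖∑ aₙ eₙ‖`. -/
def IsSymmetric (K : ℝ) (e : SchauderBasis 𝕜 X) : Prop :=
  ∀ (a ε : ℕ → 𝕜) (σ : Equiv.Perm ℕ), IsSigns ε → Converges (fun n => a n • e n) →
    Converges (fun n => (ε n * a (σ n)) • e n) ∧
      ‖seriesSum (fun n => (ε n * a (σ n)) • e n)‖ ≤ K * ‖seriesSum (fun n => a n • e n)‖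

/-- The unit vectors of `c₀`, the space of null sequences with the supremum norm. -/
def c0Unit (𝕜 : Type*) [RCLike 𝕜] (i : ℕ) : C₀(ℕ, 𝕜) where
  toFun := Pi.single i 1
  continuous_toFun := continuous_of_discreteTopology
  zero_at_infty' := by
    rw [cocompact_eq_cofinite]
    refine tendsto_const_nhds.congr' ?_
    filter_upwards [(Set.finite_singleton i).compl_mem_cofinite] with j hj
    have hj' : j ≠ i := by simpa using hj
    simp [hj']

/-- A space `F` with a basis `e`, viewed as a space of scalar sequences, lies in `c₀` and its
norm dominates the norm of `c₀`. -/
def DominatesC0 (e : SchauderBasis 𝕜 F) : Prop :=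
  ∀ z : F, ∃ y : C₀(ℕ, 𝕜), (∀ i, y i = e.coord i z) ∧ ‖y‖ ≤ ‖z‖

/-- `‖x‖_m = inf { (‖y‖_∞² + ‖z‖_F²)^{1/2} : x = m⁻¹ y + m z, y ∈ c₀, z ∈ F }` for `x ∈ c₀`,
where `z ∈ F` is identified with its sequence of coordinates. -/
def interpNorm (e : SchauderBasis 𝕜 F) (m : ℝ) (x : C₀(ℕ, 𝕜)) : ℝ :=
  sInf {r : ℝ | ∃ (y : C₀(ℕ, 𝕜)) (z : F),
    (∀ i, x i = ((1 / m : ℝ) : 𝕜) * y i + (m : 𝕜) * e.coord i z) ∧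
      r = Real.sqrt (‖y‖ ^ 2 + ‖z‖ ^ 2)}

/-- The terms of the series `∑ ‖x‖_{mₙ} fₙ`. -/
def davisTerm (e : SchauderBasis 𝕜 F) (f : SchauderBasis 𝕜 X) (m : ℕ → ℝ) (x : C₀(ℕ, 𝕜))
    (n : ℕ) : X :=
  (interpNorm e (m n) x : 𝕜) • f n

/-! ### Elementary facts on the norms `‖·‖_m` -/

lemma interpNorm_bddBelow (e : SchauderBasis 𝕜 F) (m : ℝ) (x : C₀(ℕ, 𝕜)) :
    BddBelow {r : ℝ | ∃ (y : C₀(ℕ, 𝕜)) (z : F),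
      (∀ i, x i = ((1 / m : ℝ) : 𝕜) * y i + (m : 𝕜) * e.coord i z) ∧
        r = Real.sqrt (‖y‖ ^ 2 + ‖z‖ ^ 2)} :=
  ⟨0, by rintro _ ⟨y, z, -, rfl⟩; exact Real.sqrt_nonneg _⟩

lemma interpNorm_nonneg (e : SchauderBasis 𝕜 F) (m : ℝ) (x : C₀(ℕ, 𝕜)) :
    0 ≤ interpNorm e m x :=
  Real.sInf_nonneg (by rintro _ ⟨y, z, -, rfl⟩; exact Real.sqrt_nonneg _)

lemma interpNorm_le (e : SchauderBasis 𝕜 F) {m : ℝ} {x y : C₀(ℕ, 𝕜)} {z : F}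
    (h : ∀ i, x i = ((1 / m : ℝ) : 𝕜) * y i + (m : 𝕜) * e.coord i z) :
    interpNorm e m x ≤ Real.sqrt (‖y‖ ^ 2 + ‖z‖ ^ 2) :=
  csInf_le (interpNorm_bddBelow e m x) ⟨y, z, h, rfl⟩

lemma exists_lt_of_interpNorm_lt (e : SchauderBasis 𝕜 F) {m : ℝ} (hm : 1 ≤ m) {x : C₀(ℕ, 𝕜)}
    {r : ℝ} (h : interpNorm e m x < r) :
    ∃ (y : C₀(ℕ, 𝕜)) (z : F), (∀ i, x i = ((1 / m : ℝ) : 𝕜) * y i + (m : 𝕜) * e.coord i z) ∧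
      Real.sqrt (‖y‖ ^ 2 + ‖z‖ ^ 2) < r := by
  have hm0 : (m : 𝕜) ≠ 0 := by
    have : m ≠ 0 := by linarith
    exact_mod_cast this
  have hne : {r : ℝ | ∃ (y : C₀(ℕ, 𝕜)) (z : F),
      (∀ i, x i = ((1 / m : ℝ) : 𝕜) * y i + (m : 𝕜) * e.coord i z) ∧
        r = Real.sqrt (‖y‖ ^ 2 + ‖z‖ ^ 2)}.Nonempty :=
    ⟨_, (m : 𝕜) • x, 0, fun i => by simp [hm0], rfl⟩
  obtain ⟨_, ⟨y, z, hyz, rfl⟩, hr⟩ := exists_lt_of_csInf_lt hne h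
  exact ⟨y, z, hyz, hr⟩

lemma interpNorm_add_le (e : SchauderBasis 𝕜 F) {m : ℝ} (hm : 1 ≤ m) (x x' : C₀(ℕ, 𝕜)) :
    interpNorm e m (x + x') ≤ interpNorm e m x + interpNorm e m x' := by
  refine le_of_forall_pos_le_add fun δ hδ => ?_
  obtain ⟨y, z, h, hr⟩ := exists_lt_of_interpNorm_lt e hm
    (show interpNorm e m x < interpNorm e m x + δ / 2 by linarith)
  obtain ⟨y', z', h', hr'⟩ := exists_lt_of_interpNorm_lt e hm
    (show interpNorm e m x' < interpNorm e m x' + δ / 2 by linarith)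
  have h1 : interpNorm e m (x + x') ≤ Real.sqrt (‖y + y'‖ ^ 2 + ‖z + z'‖ ^ 2) := by
    refine interpNorm_le e fun i => ?_
    simp only [ZeroAtInftyContinuousMap.add_apply, h i, h' i, map_add]
    ring
  have h2 : Real.sqrt (‖y + y'‖ ^ 2 + ‖z + z'‖ ^ 2) ≤
      Real.sqrt (‖y‖ ^ 2 + ‖z‖ ^ 2) + Real.sqrt (‖y'‖ ^ 2 + ‖z'‖ ^ 2) := by
    have := norm_add_le (WithLp.toLp 2 (y, z)) (WithLp.toLp 2 (y', z'))
    rw [WithLp.prod_norm_eq_of_L2, WithLp.prod_norm_eq_of_L2, WithLp.prod_norm_eq_of_L2] at this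
    exact this
  linarith

lemma interpNorm_smul_le (e : SchauderBasis 𝕜 F) {m : ℝ} (hm : 1 ≤ m) (c : 𝕜) (x : C₀(ℕ, 𝕜)) :
    interpNorm e m (c • x) ≤ ‖c‖ * interpNorm e m x := by
  refine le_of_forall_pos_le_add fun δ hδ => ?_
  have hc : 0 < ‖c‖ + 1 := by positivity
  obtain ⟨y, z, h, hr⟩ := exists_lt_of_interpNorm_lt e hm
    (show interpNorm e m x < interpNorm e m x + δ / (‖c‖ + 1) by linarith [div_pos hδ hc])
  have h1 : interpNorm e m (c • x) ≤ Real.sqrt (‖c • y‖ ^ 2 + ‖c • z‖ ^ 2) := by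
    refine interpNorm_le e fun i => ?_
    simp only [ZeroAtInftyContinuousMap.smul_apply, h i, map_smul, smul_eq_mul]
    ring
  have h2 : Real.sqrt (‖c • y‖ ^ 2 + ‖c • z‖ ^ 2) = ‖c‖ * Real.sqrt (‖y‖ ^ 2 + ‖z‖ ^ 2) := by
    rw [norm_smul, norm_smul, mul_pow, mul_pow, ← mul_add, Real.sqrt_mul (by positivity),
      Real.sqrt_sq (norm_nonneg c)]
  have h3 : ‖c‖ * (δ / (‖c‖ + 1)) ≤ δ := by
    rw [mul_div_assoc', div_le_iff₀ hc]
    nlinarith [norm_nonneg c]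
  have h4 := mul_le_mul_of_nonneg_left hr.le (norm_nonneg c)
  rw [mul_add] at h4
  linarith

lemma interpNorm_zero (e : SchauderBasis 𝕜 F) {m : ℝ} (hm : 1 ≤ m) :
    interpNorm e m 0 = 0 := by
  refine le_antisymm ?_ (interpNorm_nonneg e m 0)
  simpa using interpNorm_smul_le e hm (0 : 𝕜) 0

lemma norm_le_interpNorm {e : SchauderBasis 𝕜 F} (he : DominatesC0 e) {m : ℝ} (hm : 1 ≤ m)
    (x : C₀(ℕ, 𝕜)) : ‖x‖ ≤ 2 * m * interpNorm e m x := by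
  have hm0 : 0 < 2 * m := by linarith
  rw [mul_comm, ← div_le_iff₀ hm0]
  refine le_of_forall_gt_imp_ge_of_dense fun r hr => ?_
  obtain ⟨y, z, h, hr⟩ := exists_lt_of_interpNorm_lt e hm hr
  obtain ⟨w, hw, hwz⟩ := he z
  have hx : x = ((1 / m : ℝ) : 𝕜) • y + (m : 𝕜) • w := by
    ext i
    rw [h i, ZeroAtInftyContinuousMap.add_apply, ZeroAtInftyContinuousMap.smul_apply,
      ZeroAtInftyContinuousMap.smul_apply, hw i, smul_eq_mul, smul_eq_mul]
  have hy : ‖y‖ ≤ r := (Real.le_sqrt_of_sq_le (by nlinarith [sq_nonneg ‖z‖])).trans hr.le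
  have hz : ‖z‖ ≤ r := (Real.le_sqrt_of_sq_le (by nlinarith [sq_nonneg ‖y‖])).trans hr.le
  have hr0 : 0 ≤ r := (norm_nonneg _).trans hy
  have hm1 : 1 / m ≤ m := by
    rw [div_le_iff₀ (by linarith)]
    nlinarith
  rw [div_le_iff₀ hm0, hx]
  refine (norm_add_le _ _).trans ?_
  rw [norm_smul, norm_smul, RCLike.norm_ofReal, RCLike.norm_ofReal,
    abs_of_nonneg (by positivity), abs_of_nonneg (by linarith)]
  have h1 : 1 / m * ‖y‖ ≤ m * r := mul_le_mul hm1 hy (norm_nonneg _) (by linarith)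
  have h2 : m * ‖w‖ ≤ m * r := mul_le_mul_of_nonneg_left (hwz.trans hz) (by linarith)
  linarith

/-! ### Domination with respect to a `1`-unconditional basis -/

lemma hasSum_finset (e : SchauderBasis 𝕜 X) (s : Finset ℕ) (a : ℕ → 𝕜) :
    HasSum (fun n => (if n ∈ s then a n else 0) • e n) (∑ n ∈ s, a n • e n)
      (SummationFilter.conditional ℕ) := by
  have := hasSum_sum_of_ne_finset_zero (L := SummationFilter.conditional ℕ)
    (f := fun n => (if n ∈ s then a n else 0) • e n) (s := s) (fun n hn => by simp [hn])
  convert this using 1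
  exact Finset.sum_congr rfl fun n hn => by simp [hn]

lemma norm_sum_signs_le {f : SchauderBasis 𝕜 X} (hf : IsUnconditional 1 f) (s : Finset ℕ)
    (a ε : ℕ → 𝕜) (hε : IsSigns ε) :
    ‖∑ n ∈ s, (ε n * a n) • f n‖ ≤ ‖∑ n ∈ s, a n • f n‖ := by
  have h1 := hasSum_finset f s a
  have h2 := hasSum_finset f s (fun n => ε n * a n)
  have h := (hf (fun n => if n ∈ s then a n else 0) ε hε h1.summable).2
  simp only [mul_ite, mul_zero] at h
  rw [seriesSum, seriesSum, h1.tsum_eq, h2.tsum_eq, one_mul] at h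
  exact h

lemma norm_sum_update_le {f : SchauderBasis 𝕜 X} (hf : IsUnconditional 1 f) (s : Finset ℕ)
    (a : ℕ → 𝕜) {i : ℕ} (hi : i ∈ s) {t : ℝ} (ht0 : 0 ≤ t) (ht1 : t ≤ 1) :
    ‖∑ n ∈ s, (Function.update a i (t * a i) n) • f n‖ ≤ ‖∑ n ∈ s, a n • f n‖ := by
  set w := ∑ n ∈ s.erase i, a n • f n with hw
  have key : ∀ c : 𝕜, ∑ n ∈ s, (Function.update a i c n) • f n = c • f i + w := fun c => by
    rw [← Finset.add_sum_erase s _ hi, Function.update_self, hw]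
    congr 1
    refine Finset.sum_congr rfl fun n hn => ?_
    rw [Function.update_of_ne (Finset.ne_of_mem_erase hn)]
  have h0 : ∑ n ∈ s, a n • f n = a i • f i + w := by
    rw [← key (a i), Function.update_eq_self]
  have hneg : ‖(-a i) • f i + w‖ ≤ ‖a i • f i + w‖ := by
    have h := norm_sum_signs_le hf s a (Function.update 1 i (-1)) (fun n => by
      by_cases h : n = i
      · subst h; simp
      · simp [h])
    rw [h0] at h
    rw [← key (-a i)]
    convert h using 4 with n hn
    by_cases h : n = i
    · subst h; simp
    · simp [h]
  rw [key, h0]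
  have hc : ((t : 𝕜) * a i) • f i + w =
      (((1 + t) / 2 : ℝ) : 𝕜) • (a i • f i + w) + (((1 - t) / 2 : ℝ) : 𝕜) • ((-a i) • f i + w) := by
    push_cast
    module
  rw [hc]
  refine (norm_add_le _ _).trans ?_
  rw [norm_smul, norm_smul, RCLike.norm_ofReal, RCLike.norm_ofReal,
    abs_of_nonneg (by linarith), abs_of_nonneg (by linarith)]
  nlinarith [mul_le_mul_of_nonneg_left hneg (show 0 ≤ (1 - t) / 2 by linarith)]

lemma norm_sum_mono {f : SchauderBasis 𝕜 X} (hf : IsUnconditional 1 f) (s : Finset ℕ)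
    (a c : ℕ → ℝ) (ha : ∀ n, 0 ≤ a n) (hac : ∀ n, a n ≤ c n) :
    ‖∑ n ∈ s, (a n : 𝕜) • f n‖ ≤ ‖∑ n ∈ s, (c n : 𝕜) • f n‖ := by
  have main : ∀ t : Finset ℕ, t ⊆ s →
      ‖∑ n ∈ s, ((if n ∈ t then a n else c n : ℝ) : 𝕜) • f n‖ ≤ ‖∑ n ∈ s, (c n : 𝕜) • f n‖ := by
    intro t
    induction t using Finset.induction_on with
    | empty => intro _; simp
    | insert i t hit ih =>
      intro hts
      refine le_trans ?_ (ih fun n hn => hts (Finset.mem_insert_of_mem hn))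
      have hi : i ∈ s := hts (Finset.mem_insert_self i t)
      have hc0 : 0 ≤ c i := (ha i).trans (hac i)
      have h := norm_sum_update_le hf s (fun n => ((if n ∈ t then a n else c n : ℝ) : 𝕜)) hi
        (t := a i / c i) (div_nonneg (ha i) hc0) (div_le_one_of_le₀ (hac i) hc0)
      refine le_trans (le_of_eq ?_) h
      congr 1
      refine Finset.sum_congr rfl fun n hn => ?_
      congr 1
      by_cases hni : n = i
      · subst hni
        rcases hc0.eq_or_lt with h0 | h0
        · have : a n = 0 := le_antisymm (h0 ▸ hac n) (ha n)
          simp [hit, this]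
        · have : (c n : 𝕜) ≠ 0 := by exact_mod_cast h0.ne'
          simp [hit, this]
      · simp [hni]
  have h := main s subset_rfl
  refine le_trans (le_of_eq ?_) h
  congr 1
  exact Finset.sum_congr rfl fun n hn => by simp [hn]

lemma hasSum_conditional_iff {v : ℕ → X} {u : X} :
    HasSum v u (SummationFilter.conditional ℕ) ↔
      Tendsto (fun N => ∑ n ∈ Finset.range N, v n) atTop (𝓝 u) := by
  rw [HasSum, SummationFilter.conditional_filter_eq_map_range, tendsto_map'_iff]
  rfl

lemma tendsto_seriesSum {v : ℕ → X} (hv : Converges v) :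
    Tendsto (fun N => ∑ n ∈ Finset.range N, v n) atTop (𝓝 (seriesSum v)) :=
  hasSum_conditional_iff.1 hv.hasSum

lemma converges_mono [CompleteSpace X] {f : SchauderBasis 𝕜 X} (hf : IsUnconditional 1 f)
    {a c : ℕ → ℝ} (ha : ∀ n, 0 ≤ a n) (hac : ∀ n, a n ≤ c n)
    (hc : Converges (fun n => (c n : 𝕜) • f n)) : Converges (fun n => (a n : 𝕜) • f n) := by
  have h1 := (tendsto_seriesSum hc).cauchySeq
  have h2 : CauchySeq (fun N => ∑ n ∈ Finset.range N, (a n : 𝕜) • f n) := by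
    rw [Metric.cauchySeq_iff'] at h1 ⊢
    intro δ hδ
    obtain ⟨N, hN⟩ := h1 δ hδ
    refine ⟨N, fun n hn => lt_of_le_of_lt ?_ (hN n hn)⟩
    rw [dist_eq_norm, dist_eq_norm, ← Finset.sum_Ico_eq_sub _ hn, ← Finset.sum_Ico_eq_sub _ hn]
    exact norm_sum_mono hf _ a c ha hac
  obtain ⟨u, hu⟩ := cauchySeq_tendsto_of_complete h2
  exact (hasSum_conditional_iff.2 hu).summable

lemma norm_seriesSum_mono [CompleteSpace X] {f : SchauderBasis 𝕜 X} (hf : IsUnconditional 1 f)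
    {a c : ℕ → ℝ} (ha : ∀ n, 0 ≤ a n) (hac : ∀ n, a n ≤ c n)
    (hc : Converges (fun n => (c n : 𝕜) • f n)) :
    ‖seriesSum (fun n => (a n : 𝕜) • f n)‖ ≤ ‖seriesSum (fun n => (c n : 𝕜) • f n)‖ :=
  le_of_tendsto_of_tendsto' (tendsto_seriesSum (converges_mono hf ha hac hc)).norm
    (tendsto_seriesSum hc).norm fun _ => norm_sum_mono hf _ a c ha hac

lemma coord_eq_of_converges {f : SchauderBasis 𝕜 X} {a : ℕ → 𝕜}
    (h : Converges (fun n => a n • f n)) (i : ℕ) :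
    f.coord i (seriesSum (fun n => a n • f n)) = a i := by
  have h1 := ((f.coord i).continuous.tendsto _).comp (tendsto_seriesSum h)
  refine tendsto_nhds_unique h1 (tendsto_const_nhds.congr' ?_)
  filter_upwards [eventually_gt_atTop i] with N hN
  simp [f.ortho, Pi.single_apply, hN]

/-! ### The space -/

section Space

variable [CompleteSpace X]

/-- The collection of all `x ∈ c₀` for which `∑ ‖x‖_{mₙ} fₙ` converges in `X`, as a subspace. -/
def davisSubmodule (e : SchauderBasis 𝕜 F) (f : SchauderBasis 𝕜 X) (m : ℕ → ℝ)
    (hf : IsUnconditional 1 f) (hm : ∀ n, 1 ≤ m n) : Submodule 𝕜 C₀(ℕ, 𝕜) where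
  carrier := {x | Converges (davisTerm e f m x)}
  zero_mem' := by
    have h : davisTerm e f m 0 = 0 := by
      funext n
      simp [davisTerm, interpNorm_zero e (hm n)]
    simp only [Set.mem_ofPred_eq, h]
    exact summable_zero
  add_mem' := by
    intro x x' hx hx'
    refine converges_mono hf (c := fun n => interpNorm e (m n) x + interpNorm e (m n) x')
      (fun n => interpNorm_nonneg e _ _) (fun n => interpNorm_add_le e (hm n) x x') ?_
    have h := Summable.add hx hx'
    refine h.congr fun n => ?_
    simp [davisTerm, add_smul]
  smul_mem' := by
    intro c x hx
    refine converges_mono hf (c := fun n => ‖c‖ * interpNorm e (m n) x)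
      (fun n => interpNorm_nonneg e _ _) (fun n => interpNorm_smul_le e (hm n) c x) ?_
    have h := Summable.const_smul (‖c‖ : 𝕜) hx
    refine h.congr fun n => ?_
    simp [davisTerm, mul_smul]

/-- The space `Y = Y(c₀, F, X, (mₙ))`: all `x ∈ c₀` for which `∑ ‖x‖_{mₙ} fₙ` converges in `X`,
normed by `‖x‖_Y = ‖∑ ‖x‖_{mₙ} fₙ‖_X` (and not by the norm of `c₀`). -/
def DavisSpace (e : SchauderBasis 𝕜 F) (f : SchauderBasis 𝕜 X) (m : ℕ → ℝ)
    (_he : DominatesC0 e) (hf : IsUnconditional 1 f) (hm : ∀ n, 1 ≤ m n) : Type _ :=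
  davisSubmodule e f m hf hm

variable (e : SchauderBasis 𝕜 F) (f : SchauderBasis 𝕜 X) (m : ℕ → ℝ)
  (he : DominatesC0 e) (hf : IsUnconditional 1 f) (hm : ∀ n, 1 ≤ m n)

instance : AddCommGroup (DavisSpace e f m he hf hm) :=
  inferInstanceAs (AddCommGroup (davisSubmodule e f m hf hm))

instance : Module 𝕜 (DavisSpace e f m he hf hm) :=
  inferInstanceAs (Module 𝕜 (davisSubmodule e f m hf hm))

/-- The inclusion of `Y` in `c₀`. -/
def DavisSpace.toC0 : DavisSpace e f m he hf hm →ₗ[𝕜] C₀(ℕ, 𝕜) :=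
  (davisSubmodule e f m hf hm).subtype

lemma DavisSpace.converges (x : DavisSpace e f m he hf hm) :
    Converges (davisTerm e f m (DavisSpace.toC0 e f m he hf hm x)) :=
  x.2

/-- `‖x‖_Y = ‖∑ ‖x‖_{mₙ} fₙ‖_X`. -/
def davisNorm (x : C₀(ℕ, 𝕜)) : ℝ := ‖seriesSum (davisTerm e f m x)‖

lemma davisNorm_smul_le (e : SchauderBasis 𝕜 F) (f : SchauderBasis 𝕜 X) (m : ℕ → ℝ)
    (hf : IsUnconditional 1 f) (hm : ∀ n, 1 ≤ m n) (c : 𝕜) {x : C₀(ℕ, 𝕜)} (hx : Converges (davisTerm e f m x)) :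
    davisNorm e f m (c • x) ≤ ‖c‖ * davisNorm e f m x := by
  have h := Summable.const_smul (‖c‖ : 𝕜) hx
  have h1 : (fun n => ((‖c‖ * interpNorm e (m n) x : ℝ) : 𝕜) • f n) =
      fun n => (‖c‖ : 𝕜) • davisTerm e f m x n := by
    funext n
    simp [davisTerm, mul_smul]
  have h2 := norm_seriesSum_mono hf (fun n => interpNorm_nonneg e (m n) (c • x))
    (fun n => interpNorm_smul_le e (hm n) c x) (by rw [h1]; exact h)
  rw [h1, seriesSum, seriesSum, Summable.tsum_const_smul _ hx, norm_smul, RCLike.norm_ofReal,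
    abs_of_nonneg (norm_nonneg c)] at h2
  exact h2

instance : NormedAddCommGroup (DavisSpace e f m he hf hm) :=
  AddGroupNorm.toNormedAddCommGroup
    { toFun := fun x => davisNorm e f m (DavisSpace.toC0 e f m he hf hm x)
      map_zero' := by
        have := davisNorm_smul_le e f m hf hm (0 : 𝕜)
          (DavisSpace.converges e f m he hf hm 0)
        rw [norm_zero, zero_mul, zero_smul] at this
        rw [map_zero]
        exact le_antisymm this (norm_nonneg _)
      add_le' := by
        intro x x'
        have hx := DavisSpace.converges e f m he hf hm x
        have hx' := DavisSpace.converges e f m he hf hm x'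
        rw [map_add]
        set u := DavisSpace.toC0 e f m he hf hm x
        set u' := DavisSpace.toC0 e f m he hf hm x'
        have h1 : (fun n => ((interpNorm e (m n) u + interpNorm e (m n) u' : ℝ) : 𝕜) • f n) =
            fun n => davisTerm e f m u n + davisTerm e f m u' n := by
          funext n
          simp [davisTerm, add_smul]
        have h2 := norm_seriesSum_mono hf (fun n => interpNorm_nonneg e (m n) (u + u'))
          (fun n => interpNorm_add_le e (hm n) u u') (by rw [h1]; exact hx.add hx')
        rw [h1] at h2
        refine le_trans h2 ?_
        rw [seriesSum, Summable.tsum_add hx hx']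
        exact norm_add_le _ _
      neg' := by
        have key : ∀ x : DavisSpace e f m he hf hm,
            davisNorm e f m (DavisSpace.toC0 e f m he hf hm (-x)) ≤
              davisNorm e f m (DavisSpace.toC0 e f m he hf hm x) := fun x => by
          have := davisNorm_smul_le e f m hf hm (-1 : 𝕜)
            (DavisSpace.converges e f m he hf hm x)
          have hneg : (-1 : 𝕜) • DavisSpace.toC0 e f m he hf hm x =
              -DavisSpace.toC0 e f m he hf hm x := by
            ext i
            simp
          rwa [norm_neg, norm_one, one_mul, hneg, ← map_neg] at this
        intro x
        refine le_antisymm (key x) ?_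
        simpa using key (-x)
      eq_zero_of_map_eq_zero' := by
        intro x hx
        have h0 : seriesSum (davisTerm e f m (DavisSpace.toC0 e f m he hf hm x)) = 0 :=
          norm_eq_zero.1 hx
        have h1 := coord_eq_of_converges (f := f) (DavisSpace.converges e f m he hf hm x) 0
        have h2 : interpNorm e (m 0) (DavisSpace.toC0 e f m he hf hm x) = 0 := by
          have h3 : ((interpNorm e (m 0) (DavisSpace.toC0 e f m he hf hm x) : ℝ) : 𝕜) = 0 := by
            rw [← h1]
            exact (congrArg (f.coord 0) h0).trans (map_zero _)
          exact_mod_cast h3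
        have h3 := norm_le_interpNorm he (hm 0) (DavisSpace.toC0 e f m he hf hm x)
        rw [h2, mul_zero] at h3
        exact Subtype.ext (norm_le_zero_iff.1 h3) }

lemma DavisSpace.norm_def (x : DavisSpace e f m he hf hm) :
    ‖x‖ = ‖seriesSum (davisTerm e f m (DavisSpace.toC0 e f m he hf hm x))‖ :=
  rfl

instance : NormedSpace 𝕜 (DavisSpace e f m he hf hm) where
  norm_smul_le c x := davisNorm_smul_le e f m hf hm c (DavisSpace.converges e f m he hf hm x)

end Space

end Davis

end

/-! Reflexivity of `X` makes the basis `f` both shrinking and boundedly complete. Each property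
controls the sequences that are bounded in `Y` and converge coordinatewise.

If the limit is 0, the sequence is weakly null (`DavisSpace.tendsto_zero_of_coord`). Otherwise a
subsequence, after rotation, satisfies Re g ≥ ε for some functional g. It is weakly null in `c₀`, so
Mazur's lemma gives convex combinations u tending to 0 in sup norm. Then each `‖u‖_{mₙ}` tends to 0,
so the vectors `∑ ‖u‖_{mₙ} fₙ` are bounded and coordinatewise null, hence weakly null in `X`. A
second use of Mazur's lemma makes their convex combinations small in `X`. By convexity of the norms
`‖·‖_{mₙ}` the same combinations of the u are small in `Y`, yet Re g ≥ ε survives: a contradiction.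

In general the limit x lies in `Y`. In a splitting y/mₙ + mₙz with 1/mₙ small, large coordinates
come from z, and a bounded z has boundedly many of them because `‖∑_{i<n} eᵢ‖` tends to infinity; so
x is a null sequence (`tendsto_zero_of_interpNorm_le`). Lower semicontinuity of the norms
(`eventually_interpNorm_le`) and bounded completeness make `∑ ‖x‖_{mₙ} fₙ` converge.

Given φ in the bidual, Goldstine's theorem on the coordinate functionals produces such an x. For any
g, a bounded sequence approximating φ on g and on all coordinates differs from x by a weakly null
sequence, so φ(g) = g(x). -/

noncomputable section

namespace Davis

/-! ### Mazur, Goldstine, and bases of reflexive spaces -/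

section Generic

variable {𝕜 : Type*} [RCLike 𝕜] {V : Type*} [NormedAddCommGroup V] [NormedSpace 𝕜 V]

/-- **Mazur's lemma**: a weakly null sequence has convex combinations of arbitrarily small norm. -/
lemma exists_convexCombination_norm_lt {v : ℕ → V}
    (hv : ∀ h : StrongDual 𝕜 V, Tendsto (fun k => h (v k)) atTop (𝓝 0)) {δ : ℝ} (hδ : 0 < δ) :
    ∃ t : ℕ →₀ ℝ, (∀ k, 0 ≤ t k) ∧ ∑ k ∈ t.support, t k = 1 ∧
      ‖∑ k ∈ t.support, (t k : 𝕜) • v k‖ < δ := by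
  let _ : NormedSpace ℝ V := NormedSpace.restrictScalars ℝ 𝕜 V
  have : IsScalarTower ℝ 𝕜 V := RestrictScalars.isScalarTower ℝ 𝕜 V
  have hsm : ∀ (a : ℝ) (w : V), a • w = (a : 𝕜) • w := fun a w => RCLike.real_smul_eq_coe_smul a w
  -- The convex hull of the sequence is taken as the linear image of the finitely supported
  -- probability weights, so that the weights are available at the end.
  set T : Set (ℕ →₀ ℝ) :=
    {t | (∀ k, 0 ≤ t k) ∧ Finsupp.linearCombination ℝ (fun _ : ℕ => (1 : ℝ)) t = 1} with hT
  have hTc : Convex ℝ T := by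
    rintro t ⟨ht, ht1⟩ t' ⟨ht', ht1'⟩ a b ha hb hab
    refine ⟨fun k => ?_, ?_⟩
    · have := ht k
      have := ht' k
      simp only [Finsupp.add_apply, Finsupp.smul_apply, smul_eq_mul]
      positivity
    · rw [map_add, map_smul, map_smul, ht1, ht1']
      simpa using hab
  set C : Set V := Finsupp.linearCombination ℝ v '' T with hC
  have hCc : Convex ℝ C := hTc.linear_image _
  have h0 : (0 : V) ∈ closure C := by
    by_contra hcon
    obtain ⟨h, u, hu0, hu⟩ := RCLike.geometric_hahn_banach_point_closed (𝕜 := 𝕜) hCc.closure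
      isClosed_closure hcon
    rw [map_zero, map_zero] at hu0
    have hlim : Tendsto (fun k => RCLike.re (h (v k))) atTop (𝓝 0) := by
      simpa [Function.comp_def] using (RCLike.continuous_re.tendsto (0 : 𝕜)).comp (hv h)
    obtain ⟨k, hk⟩ := (hlim.eventually (gt_mem_nhds hu0)).exists
    refine lt_asymm hk (hu _ (subset_closure ⟨Finsupp.single k 1, ⟨fun j => ?_, ?_⟩, ?_⟩))
    · rw [Finsupp.single_apply]
      split_ifs <;> norm_num
    · simp
    · simp
  obtain ⟨_, ⟨t, ⟨ht, ht1⟩, rfl⟩, hlt⟩ := Metric.mem_closure_iff.1 h0 δ hδ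
  refine ⟨t, ht, ?_, ?_⟩
  · simpa [Finsupp.linearCombination_apply, Finsupp.sum] using ht1
  · rw [dist_zero_left, Finsupp.linearCombination_apply, Finsupp.sum] at hlt
    simpa only [hsm] using hlt

/-- A finite-dimensional form of **Goldstine's theorem** (Helly's lemma). -/
lemma exists_norm_le_forall_norm_sub_lt (φ : StrongDual 𝕜 (StrongDual 𝕜 V)) {R : ℝ} (hR : 0 < R)
    (hφ : ‖φ‖ ≤ R) {ι : Type*} [Fintype ι] (G : ι → StrongDual 𝕜 V) {δ : ℝ} (hδ : 0 < δ) :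
    ∃ y : V, ‖y‖ ≤ R ∧ ∀ i, ‖G i y - φ (G i)‖ < δ := by
  classical
  set A : Set (ι → 𝕜) := (fun y i => G i y) '' Metric.closedBall (0 : V) R with hA
  have hAc : Convex ℝ A := by
    rintro _ ⟨y, hy, rfl⟩ _ ⟨y', hy', rfl⟩ a b ha hb hab
    rw [mem_closedBall_zero_iff] at hy hy'
    refine ⟨(a : 𝕜) • y + (b : 𝕜) • y', ?_, ?_⟩
    · rw [mem_closedBall_zero_iff]
      refine (norm_add_le _ _).trans ?_
      rw [norm_smul, norm_smul, RCLike.norm_ofReal, RCLike.norm_ofReal, abs_of_nonneg ha,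
        abs_of_nonneg hb]
      calc a * ‖y‖ + b * ‖y'‖ ≤ a * R + b * R := by gcongr
        _ = R := by rw [← add_mul, hab, one_mul]
    · funext i
      simp [RCLike.real_smul_eq_coe_mul]
  have hmem : (fun i => φ (G i)) ∈ closure A := by
    by_contra hcon
    obtain ⟨F, u, hu, hup⟩ := RCLike.geometric_hahn_banach_closed_point (𝕜 := 𝕜) hAc.closure
      isClosed_closure hcon
    have hF : ∀ x : ι → 𝕜, F x = ∑ i, x i * F (Pi.single i 1) := fun x => by
      conv_lhs => rw [pi_eq_sum_univ' x, map_sum]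
      exact Finset.sum_congr rfl fun i _ => by
        rw [map_smul, smul_eq_mul]
    -- The separating functional on the finite product pulls back to a combination h of the `G i`
    -- with norm at most u/R, while Re φ(h) > u; this contradicts ‖φ‖ ≤ R.
    set h : StrongDual 𝕜 V := ∑ i, F (Pi.single i 1) • G i with hh
    have hhy : ∀ y, h y = F (fun i => G i y) := fun y => by
      rw [hF, hh]
      simp [mul_comm]
    have hφh : φ h = F (fun i => φ (G i)) := by
      rw [hF, hh]
      simp [mul_comm]
    have hlt : ∀ y : V, ‖y‖ ≤ R → RCLike.re (h y) < u := fun y hy => by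
      rw [hhy]
      exact hu _ (subset_closure ⟨y, mem_closedBall_zero_iff.2 hy, rfl⟩)
    have hu0 : 0 < u := by simpa using hlt 0 (by simpa using hR.le)
    have hnorm : ‖h‖ ≤ u / R := by
      refine ContinuousLinearMap.opNorm_le_of_unit_norm (by positivity) fun y hy => ?_
      -- A unimodular factor turns the bound on the real part into a bound on the modulus.
      obtain ⟨c, hc, hcy⟩ := RCLike.exists_norm_eq_mul_self (h y)
      have := hlt (((R : 𝕜) * c) • y) (by
        rw [norm_smul, norm_mul, hc, hy, RCLike.norm_ofReal, abs_of_pos hR]; simp)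
      rw [map_smul, smul_eq_mul, mul_assoc, ← hcy, RCLike.re_ofReal_mul, RCLike.ofReal_re] at this
      rw [le_div_iff₀ hR]
      linarith
    have h1 : RCLike.re (φ h) ≤ u := by
      refine (RCLike.re_le_norm _).trans ((φ.le_opNorm h).trans ?_)
      calc ‖φ‖ * ‖h‖ ≤ R * (u / R) := by gcongr
        _ = u := by field_simp
    rw [hφh] at h1
    linarith
  obtain ⟨_, ⟨y, hy, rfl⟩, hlt⟩ := Metric.mem_closure_iff.1 hmem δ hδ
  refine ⟨y, mem_closedBall_zero_iff.1 hy, fun i => ?_⟩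
  rw [dist_comm, dist_eq_norm] at hlt
  exact lt_of_le_of_lt (norm_le_pi_norm ((fun i => G i y) - fun i => φ (G i)) i) hlt

/-- **Goldstine's theorem** for countably many functionals. -/
lemma exists_seq_tendsto_bidual (φ : StrongDual 𝕜 (StrongDual 𝕜 V)) (G : ℕ → StrongDual 𝕜 V) :
    ∃ y : ℕ → V, (∀ k, ‖y k‖ ≤ ‖φ‖ + 1) ∧
      ∀ i, Tendsto (fun k => G i (y k)) atTop (𝓝 (φ (G i))) := by
  -- The k-th vector handles only the first k functionals, with error 1/(k+1). The radius ‖φ‖ + 1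
  -- stays positive when φ = 0.
  have h : ∀ k : ℕ, ∃ y : V, ‖y‖ ≤ ‖φ‖ + 1 ∧
      ∀ i : Fin k, ‖G i y - φ (G i)‖ < 1 / ((k : ℝ) + 1) := fun k =>
    exists_norm_le_forall_norm_sub_lt φ (by positivity) (by linarith) (fun i : Fin k => G i)
      (by positivity)
  choose y hy hyG using h
  refine ⟨y, hy, fun i => ?_⟩
  rw [tendsto_iff_norm_sub_tendsto_zero]
  refine squeeze_zero' (Eventually.of_forall fun k => norm_nonneg _) ?_
    tendsto_one_div_add_atTop_nhds_zero_nat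
  filter_upwards [eventually_gt_atTop i] with k hk
  exact (hyG k ⟨i, hk⟩).le

/-- In a reflexive space bounded sequences converge weakly along ultrafilters. -/
lemma IsReflexive.exists_tendsto_ultrafilter (hV : IsReflexive 𝕜 V) {w : ℕ → V} {R : ℝ}
    (hw : ∀ k, ‖w k‖ ≤ R) (U : Ultrafilter ℕ) :
    ∃ x : V, ∀ g : StrongDual 𝕜 V, Tendsto (fun k => g (w k)) U (𝓝 (g x)) := by
  -- Banach–Alaoglu gives a weak* limit in the bidual, and reflexivity brings it back to `V`.
  have hK := WeakDual.isCompact_closedBall (0 : StrongDual 𝕜 (StrongDual 𝕜 V)) R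
  set W : ℕ → WeakDual 𝕜 (StrongDual 𝕜 V) := fun k =>
    StrongDual.toWeakDual (NormedSpace.inclusionInDoubleDual 𝕜 V (w k)) with hW
  obtain ⟨ψ, -, hψ⟩ := hK.ultrafilter_le_nhds (U.map W) (by
    rw [le_principal_iff]
    refine Ultrafilter.mem_map.2 (Filter.univ_mem' fun k => ?_)
    simp only [Set.mem_preimage, mem_closedBall_zero_iff]
    exact (NormedSpace.double_dual_bound 𝕜 V (w k)).trans (hw k))
  obtain ⟨x, hx⟩ := hV (WeakDual.toStrongDual ψ)
  refine ⟨x, fun g => ?_⟩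
  have h1 : Tendsto W U (𝓝 ψ) := hψ
  have h2 := ((WeakDual.eval_continuous g).tendsto ψ).comp h1
  have h3 : g x = ψ g := by
    rw [← NormedSpace.dual_def 𝕜 V x g, hx]
    rfl
  rw [h3]
  exact h2

/-- A basis of a reflexive space is shrinking: bounded coordinatewise null sequences are weakly
null. -/
lemma IsReflexive.tendsto_zero_of_coord (hV : IsReflexive 𝕜 V) (b : SchauderBasis 𝕜 V)
    {w : ℕ → V} {R : ℝ} (hw : ∀ k, ‖w k‖ ≤ R)
    (hc : ∀ n, Tendsto (fun k => b.coord n (w k)) atTop (𝓝 0)) (g : StrongDual 𝕜 V) :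
    Tendsto (fun k => g (w k)) atTop (𝓝 0) := by
  rw [tendsto_iff_ultrafilter]
  intro U hU
  obtain ⟨x, hx⟩ := hV.exists_tendsto_ultrafilter hw U
  have hx0 : x = 0 := by
    have h0 : ∀ n, b.coord n x = 0 := fun n =>
      tendsto_nhds_unique (hx (b.coord n)) ((hc n).mono_left hU)
    refine (b.expansion x).unique ?_
    simp [h0]
  simpa [hx0] using hx g

/-- A basis of a reflexive space is boundedly complete. -/
lemma IsReflexive.converges_of_bounded (hV : IsReflexive 𝕜 V) (b : SchauderBasis 𝕜 V)
    {a : ℕ → 𝕜} {R : ℝ} (ha : ∀ N, ‖∑ n ∈ Finset.range N, a n • b n‖ ≤ R) :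
    Converges (fun n => a n • b n) := by
  -- The weak limit x of the partial sums has coordinates `a`, so the given series is the basis
  -- expansion of x.
  obtain ⟨x, hx⟩ := hV.exists_tendsto_ultrafilter ha (Ultrafilter.of atTop)
  have h0 : ∀ n, b.coord n x = a n := fun n => by
    refine tendsto_nhds_unique (hx (b.coord n)) (tendsto_const_nhds.congr' ?_)
    filter_upwards [(Ultrafilter.of_le atTop) (eventually_gt_atTop n)] with N hN
    have hN' : n < N := hN
    simp [b.ortho, Pi.single_apply, hN']
  have h := (b.expansion x).summable
  simpa only [h0] using h

end Generic

/-! ### The space `c₀` and its dual -/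

section NullSequences

variable {𝕜 : Type*} [RCLike 𝕜]

lemma c0_norm_le {x : C₀(ℕ, 𝕜)} {C : ℝ} (hC : 0 ≤ C) : ‖x‖ ≤ C ↔ ∀ i, ‖x i‖ ≤ C := by
  rw [← ZeroAtInftyContinuousMap.norm_toBCF_eq_norm, BoundedContinuousFunction.norm_le hC]
  rfl

lemma c0_norm_apply_le (x : C₀(ℕ, 𝕜)) (i : ℕ) : ‖x i‖ ≤ ‖x‖ :=
  (c0_norm_le (norm_nonneg x)).1 le_rfl i

lemma c0_tendsto_zero (x : C₀(ℕ, 𝕜)) : Tendsto x atTop (𝓝 0) := by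
  have h := x.zero_at_infty'
  rw [cocompact_eq_cofinite, Nat.cofinite_eq_atTop] at h
  exact h

/-- The element of `c₀` given by a null sequence. -/
def c0OfTendsto (a : ℕ → 𝕜) (ha : Tendsto a atTop (𝓝 0)) : C₀(ℕ, 𝕜) where
  toFun := a
  continuous_toFun := continuous_of_discreteTopology
  zero_at_infty' := by
    rw [cocompact_eq_cofinite, Nat.cofinite_eq_atTop]
    exact ha

/-- The coordinate functionals of `c₀`. -/
def c0Coord (𝕜 : Type*) [RCLike 𝕜] (i : ℕ) : StrongDual 𝕜 C₀(ℕ, 𝕜) :=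
  LinearMap.mkContinuous
    { toFun := fun x => x i
      map_add' := fun _ _ => rfl
      map_smul' := fun _ _ => rfl } 1 fun x => by simpa using c0_norm_apply_le x i

lemma c0Coord_apply (i : ℕ) (x : C₀(ℕ, 𝕜)) : c0Coord 𝕜 i x = x i :=
  rfl

lemma c0Unit_apply (i j : ℕ) : c0Unit 𝕜 i j = if j = i then 1 else 0 := by
  change Pi.single (M := fun _ => 𝕜) i (1 : 𝕜) j = _
  rw [Pi.single_apply]

lemma c0_sum_smul_unit_apply (s : Finset ℕ) (a : ℕ → 𝕜) (j : ℕ) :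
    (∑ i ∈ s, a i • c0Unit 𝕜 i) j = if j ∈ s then a j else 0 := by
  rw [← c0Coord_apply, map_sum]
  simp [c0Coord_apply, c0Unit_apply]

/-- The truncation of a null sequence to its first `N` terms. -/
def c0Trunc (N : ℕ) (x : C₀(ℕ, 𝕜)) : C₀(ℕ, 𝕜) :=
  ∑ i ∈ Finset.range N, x i • c0Unit 𝕜 i

lemma c0Trunc_apply (N : ℕ) (x : C₀(ℕ, 𝕜)) (j : ℕ) :
    c0Trunc N x j = if j < N then x j else 0 := by
  simp [c0Trunc, c0_sum_smul_unit_apply]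

lemma c0Trunc_norm_le (N : ℕ) (x : C₀(ℕ, 𝕜)) : ‖c0Trunc N x‖ ≤ ‖x‖ := by
  rw [c0_norm_le (norm_nonneg x)]
  intro i
  rw [c0Trunc_apply]
  split_ifs
  · exact c0_norm_apply_le x i
  · simp

lemma tendsto_c0Trunc (x : C₀(ℕ, 𝕜)) : Tendsto (fun N => c0Trunc N x) atTop (𝓝 x) := by
  rw [Metric.tendsto_atTop]
  intro δ hδ
  obtain ⟨N₀, hN₀⟩ := Metric.tendsto_atTop.1 (c0_tendsto_zero x) (δ / 2) (by positivity)
  refine ⟨N₀, fun N hN => ?_⟩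
  rw [dist_eq_norm]
  refine lt_of_le_of_lt ((c0_norm_le (half_pos hδ).le).2 fun i => ?_) (half_lt_self hδ)
  rw [ZeroAtInftyContinuousMap.sub_apply, c0Trunc_apply]
  split_ifs with h
  · simpa using (half_pos hδ).le
  · have := hN₀ i (by omega)
    rw [dist_zero_right] at this
    simpa using this.le

lemma tendsto_c0Trunc_of_coord (N : ℕ) {v : ℕ → C₀(ℕ, 𝕜)} {x : C₀(ℕ, 𝕜)}
    (hc : ∀ i, Tendsto (fun k => v k i) atTop (𝓝 (x i))) :
    Tendsto (fun k => c0Trunc N (v k)) atTop (𝓝 (c0Trunc N x)) :=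
  tendsto_finsetSum _ fun i _ => (hc i).smul_const _

/-- Finitely supported vectors with unimodular entries aligning the values of h have sup norm at
most 1, so ‖h‖ bounds every partial sum. -/
lemma c0_summable_dual (h : StrongDual 𝕜 C₀(ℕ, 𝕜)) : Summable fun i => ‖h (c0Unit 𝕜 i)‖ := by
  refine summable_of_sum_le (c := ‖h‖) (fun i => norm_nonneg _) fun s => ?_
  choose c hc hch using fun i => RCLike.exists_norm_eq_mul_self (h (c0Unit 𝕜 i))
  have h1 : ((∑ i ∈ s, ‖h (c0Unit 𝕜 i)‖ : ℝ) : 𝕜) = h (∑ i ∈ s, c i • c0Unit 𝕜 i) := by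
    rw [map_sum]
    push_cast
    exact Finset.sum_congr rfl fun i _ => by rw [map_smul, smul_eq_mul, ← hch i]
  have h2 : ‖∑ i ∈ s, c i • c0Unit 𝕜 i‖ ≤ 1 := by
    rw [c0_norm_le zero_le_one]
    intro i
    rw [c0_sum_smul_unit_apply]
    split_ifs
    · exact (hc i).le
    · simp
  have h3 : ‖((∑ i ∈ s, ‖h (c0Unit 𝕜 i)‖ : ℝ) : 𝕜)‖ ≤ ‖h‖ := by
    rw [h1]
    exact (h.le_opNorm _).trans (mul_le_of_le_one_right (norm_nonneg h) h2)
  rw [RCLike.norm_ofReal] at h3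
  exact (le_abs_self _).trans h3

lemma c0_dual_apply (h : StrongDual 𝕜 C₀(ℕ, 𝕜)) (x : C₀(ℕ, 𝕜)) :
    h x = ∑' i, x i * h (c0Unit 𝕜 i) := by
  have hs : Summable fun i => x i * h (c0Unit 𝕜 i) := by
    refine Summable.of_norm_bounded ((c0_summable_dual h).mul_left ‖x‖) fun i => ?_
    rw [norm_mul]
    gcongr
    exact c0_norm_apply_le x i
  refine tendsto_nhds_unique ((h.continuous.tendsto x).comp (tendsto_c0Trunc x)) ?_
  refine hs.hasSum.tendsto_sum_nat.congr fun N => ?_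
  simp [c0Trunc]

/-- Bounded coordinatewise null sequences in `c₀` are weakly null. -/
lemma c0_tendsto_zero_of_coord {v : ℕ → C₀(ℕ, 𝕜)} {R : ℝ} (hv : ∀ k, ‖v k‖ ≤ R)
    (hc : ∀ i, Tendsto (fun k => v k i) atTop (𝓝 0)) (h : StrongDual 𝕜 C₀(ℕ, 𝕜)) :
    Tendsto (fun k => h (v k)) atTop (𝓝 0) := by
  have := tendsto_tsum_of_dominated_convergence (𝓕 := atTop)
    (f := fun k i => v k i * h (c0Unit 𝕜 i)) (g := fun _ => (0 : 𝕜))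
    ((c0_summable_dual h).mul_left R) (fun i => by simpa using (hc i).mul_const (h (c0Unit 𝕜 i)))
    (Eventually.of_forall fun k i => by
      rw [norm_mul]
      gcongr
      exact (c0_norm_apply_le _ i).trans (hv k))
  rw [tsum_zero] at this
  exact this.congr fun k => (c0_dual_apply h (v k)).symm

end NullSequences

/-! ### Multipliers on a `1`-unconditional basis -/

section Multipliers

variable {𝕜 : Type*} [RCLike 𝕜] {X : Type*} [NormedAddCommGroup X] [NormedSpace 𝕜 X]

lemma IsSymmetric.isUnconditional {e : SchauderBasis 𝕜 X} {K : ℝ} (he : IsSymmetric K e) :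
    IsUnconditional K e :=
  fun a ε hε ha => he a ε (Equiv.refl ℕ) hε ha

lemma norm_sum_mul_le_of_mem_Icc {f : SchauderBasis 𝕜 X} (hf : IsUnconditional 1 f) (s : Finset ℕ)
    (a : ℕ → 𝕜) {t : ℕ → ℝ} (ht0 : ∀ n, 0 ≤ t n) (ht1 : ∀ n, t n ≤ 1) :
    ‖∑ n ∈ s, ((t n : 𝕜) * a n) • f n‖ ≤ ‖∑ n ∈ s, a n • f n‖ := by
  have main : ∀ r : Finset ℕ, r ⊆ s →
      ‖∑ n ∈ s, (if n ∈ r then (t n : 𝕜) * a n else a n) • f n‖ ≤ ‖∑ n ∈ s, a n • f n‖ := by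
    intro r
    induction r using Finset.induction_on with
    | empty => intro _; simp
    | insert i r hir ih =>
      intro hrs
      refine le_trans (le_of_eq ?_) ((norm_sum_update_le hf s
        (fun n => if n ∈ r then (t n : 𝕜) * a n else a n) (hrs (Finset.mem_insert_self i r))
        (ht0 i) (ht1 i)).trans (ih fun n hn => hrs (Finset.mem_insert_of_mem hn)))
      congr 1
      refine Finset.sum_congr rfl fun n _ => ?_
      by_cases hni : n = i
      · subst hni
        simp [hir]
      · simp [hni]
  refine le_trans (le_of_eq ?_) (main s subset_rfl)
  congr 1
  exact Finset.sum_congr rfl fun n hn => by simp [hn]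

/-- A real multiplier is a sign times a modulus in [0, 1], and neither factor increases the norm. -/
lemma norm_sum_real_mul_le {f : SchauderBasis 𝕜 X} (hf : IsUnconditional 1 f) (s : Finset ℕ)
    (a : ℕ → 𝕜) {t : ℕ → ℝ} (ht : ∀ n, |t n| ≤ 1) :
    ‖∑ n ∈ s, ((t n : 𝕜) * a n) • f n‖ ≤ ‖∑ n ∈ s, a n • f n‖ := by
  have h1 := norm_sum_signs_le hf s (fun n => ((|t n| : ℝ) : 𝕜) * a n)
    (fun n => if 0 ≤ t n then 1 else -1) (fun n => by beta_reduce; split_ifs <;> simp)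
  refine le_trans (le_of_eq ?_)
    (h1.trans (norm_sum_mul_le_of_mem_Icc hf s a (fun n => abs_nonneg (t n)) ht))
  congr 1
  refine Finset.sum_congr rfl fun n _ => ?_
  split_ifs with h
  · rw [abs_of_nonneg h, one_mul]
  · rw [abs_of_neg (not_le.1 h)]
    push_cast
    ring_nf

/-- Bounded multipliers act boundedly on a `1`-unconditional basis. -/
lemma norm_sum_mul_le {f : SchauderBasis 𝕜 X} (hf : IsUnconditional 1 f) (s : Finset ℕ)
    (a : ℕ → 𝕜) {c : ℕ → 𝕜} (hc : ∀ n, ‖c n‖ ≤ 1) :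
    ‖∑ n ∈ s, (c n * a n) • f n‖ ≤ 2 * ‖∑ n ∈ s, a n • f n‖ := by
  have h1 := norm_sum_real_mul_le hf s a (t := fun n => RCLike.re (c n))
    fun n => (RCLike.abs_re_le_norm _).trans (hc n)
  have h2 := norm_sum_real_mul_le hf s a (t := fun n => RCLike.im (c n))
    fun n => (RCLike.abs_im_le_norm _).trans (hc n)
  -- The real and imaginary parts each cost a factor 1, whence the constant 2.
  have h3 : ∑ n ∈ s, (c n * a n) • f n = ∑ n ∈ s, ((RCLike.re (c n) : 𝕜) * a n) • f n +
      (RCLike.I : 𝕜) • ∑ n ∈ s, ((RCLike.im (c n) : 𝕜) * a n) • f n := by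
    rw [Finset.smul_sum, ← Finset.sum_add_distrib]
    refine Finset.sum_congr rfl fun n _ => ?_
    rw [smul_smul, ← add_smul]
    congr 1
    conv_lhs => rw [← RCLike.re_add_im (c n)]
    ring
  have h4 : ‖(RCLike.I : 𝕜)‖ ≤ 1 := by
    rcases RCLike.I_mul_I (K := 𝕜) with h | h
    · simp [h]
    · have h5 : ‖(RCLike.I : 𝕜)‖ * ‖(RCLike.I : 𝕜)‖ = 1 := by rw [← norm_mul, h]; simp
      nlinarith [norm_nonneg (RCLike.I : 𝕜)]
  rw [h3]
  refine (norm_add_le _ _).trans ?_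
  rw [norm_smul]
  have h6 := mul_le_of_le_one_left
    (norm_nonneg (∑ n ∈ s, ((RCLike.im (c n) : 𝕜) * a n) • f n)) h4
  linarith

lemma norm_sum_subset_le {f : SchauderBasis 𝕜 X} (hf : IsUnconditional 1 f) {A s : Finset ℕ}
    (hA : A ⊆ s) (a : ℕ → 𝕜) : ‖∑ n ∈ A, a n • f n‖ ≤ ‖∑ n ∈ s, a n • f n‖ := by
  have h := norm_sum_real_mul_le hf s a (t := fun n => if n ∈ A then 1 else 0)
    fun n => by split_ifs <;> simp
  refine le_trans (le_of_eq ?_) h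
  congr 1
  rw [← Finset.inter_eq_right.2 hA, ← Finset.sum_ite_mem]
  refine Finset.sum_congr rfl fun n hn => ?_
  split_ifs with h <;> simp_all

lemma norm_proj_le {f : SchauderBasis 𝕜 X} (hf : IsUnconditional 1 f) (A : Finset ℕ) (z : X) :
    ‖∑ n ∈ A, f.coord n z • f n‖ ≤ ‖z‖ := by
  have h := (hasSum_conditional_iff.1 (f.expansion z)).norm
  refine ge_of_tendsto h ?_
  filter_upwards [eventually_ge_atTop (A.sup id + 1)] with N hN
  refine norm_sum_subset_le hf (fun i hi => ?_) fun n => f.coord n z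
  have : i ≤ A.sup id := Finset.le_sup (f := id) hi
  exact Finset.mem_range.2 (by omega)

lemma coord_sum {f : SchauderBasis 𝕜 X} (A : Finset ℕ) (a : ℕ → 𝕜) (j : ℕ) :
    f.coord j (∑ n ∈ A, a n • f n) = if j ∈ A then a j else 0 := by
  simp [f.ortho, Pi.single_apply]

end Multipliers

/-! ### The symmetric basis of `F` and the norms `‖·‖_m` -/

section Symmetric

variable {𝕜 : Type*} [RCLike 𝕜] {F : Type*} [NormedAddCommGroup F] [NormedSpace 𝕜 F]

/-- The multipliers ε/zᵢ for i in A have modulus at most 1 and flatten z on A to the constant ε. -/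
lemma mul_norm_sum_basis_le {e : SchauderBasis 𝕜 F} (he : IsUnconditional 1 e) {ε : ℝ}
    (hε : 0 < ε) (z : F) (A : Finset ℕ) (hA : ∀ i ∈ A, ε ≤ ‖e.coord i z‖) :
    ε * ‖∑ i ∈ A, e i‖ ≤ 2 * ‖z‖ := by
  have h := norm_sum_mul_le he A (fun i => e.coord i z)
    (c := fun i => if i ∈ A then (ε : 𝕜) / e.coord i z else 0) fun i => by
      split_ifs with hi
      · rw [norm_div, RCLike.norm_ofReal, abs_of_pos hε]
        exact div_le_one_of_le₀ (hA i hi) (norm_nonneg _)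
      · simp
  have h1 : ∑ i ∈ A, ((if i ∈ A then (ε : 𝕜) / e.coord i z else 0) * e.coord i z) • e i =
      (ε : 𝕜) • ∑ i ∈ A, e i := by
    rw [Finset.smul_sum]
    refine Finset.sum_congr rfl fun i hi => ?_
    have hne : e.coord i z ≠ 0 := norm_pos_iff.1 (hε.trans_le (hA i hi))
    rw [if_pos hi, div_mul_cancel₀ _ hne]
  rw [h1, norm_smul, RCLike.norm_ofReal, abs_of_pos hε] at h
  linarith [norm_proj_le he A z]

/-- The permutations of `ℕ` act transitively on injective tuples of each finite length. -/
lemma exists_perm_mem_iff_lt_card (A : Finset ℕ) :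
    ∃ σ : Equiv.Perm ℕ, ∀ k, σ k ∈ A ↔ k < A.card := by
  have := Equiv.Perm.isMultiplyPretransitive ℕ A.card
  obtain ⟨σ, hσ⟩ := MulAction.exists_smul_eq (Equiv.Perm ℕ) (Fin.valEmbedding (n := A.card))
    (A.orderEmbOfFin rfl).toEmbedding
  have h : ∀ i : Fin A.card, σ i = A.orderEmbOfFin rfl i := fun i => DFunLike.congr_fun hσ i
  refine ⟨σ, fun k => ⟨fun hk => ?_, fun hk => ?_⟩⟩
  · obtain ⟨i, hi⟩ : σ k ∈ Set.range (A.orderEmbOfFin rfl) := by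
      rw [Finset.range_orderEmbOfFin]
      exact hk
    rw [← h i] at hi
    rw [← σ.injective hi]
    exact i.2
  · rw [show σ k = _ from h ⟨k, hk⟩]
    exact A.orderEmbOfFin_mem rfl _

lemma IsSymmetric.norm_sum_range_card_le {e : SchauderBasis 𝕜 F} (he : IsSymmetric 1 e)
    (A : Finset ℕ) : ‖∑ i ∈ Finset.range A.card, e i‖ ≤ ‖∑ i ∈ A, e i‖ := by
  obtain ⟨σ, hσ⟩ := exists_perm_mem_iff_lt_card A
  have h1 := hasSum_finset e A (fun _ => (1 : 𝕜))
  have h2 := hasSum_finset e (Finset.range A.card) (fun _ => (1 : 𝕜))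
  have h := (he (fun n => if n ∈ A then 1 else 0) 1 σ (fun _ => Or.inl rfl) h1.summable).2
  simp only [Finset.mem_range] at h2
  simp only [hσ, Pi.one_apply, one_mul] at h
  rw [seriesSum, seriesSum, h1.tsum_eq, h2.tsum_eq] at h
  simpa using h

lemma exists_forall_lt_norm_sum_range {e : SchauderBasis 𝕜 F} (he : DominatesC0 e)
    (hr : Tendsto (fun n : ℕ =>
      ‖∑ i ∈ Finset.range n, c0Unit 𝕜 i‖ / ‖∑ i ∈ Finset.range n, e i‖) atTop (𝓝 0)) (B : ℝ) :
    ∃ N, ∀ n, N ≤ n → B < ‖∑ i ∈ Finset.range n, e i‖ := by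
  have hB : 0 < |B| + 1 := by positivity
  obtain ⟨N, hN⟩ := eventually_atTop.1 (hr.eventually (gt_mem_nhds (one_div_pos.2 hB)))
  -- The shift ensures n ≥ 1: then index 0 occurs, both norms are at least 1, and a small ratio
  -- forces a large denominator.
  refine ⟨N + 1, fun n hn => ?_⟩
  have h0 : (0 : ℕ) ∈ Finset.range n := Finset.mem_range.2 (by omega)
  have hc0 : 1 ≤ ‖∑ i ∈ Finset.range n, c0Unit 𝕜 i‖ := by
    have h := c0_norm_apply_le (∑ i ∈ Finset.range n, (1 : 𝕜) • c0Unit 𝕜 i) 0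
    rw [c0_sum_smul_unit_apply (Finset.range n) (fun _ => 1) 0, if_pos h0, norm_one] at h
    simpa using h
  have hF : 1 ≤ ‖∑ i ∈ Finset.range n, e i‖ := by
    obtain ⟨y, hy, hyn⟩ := he (∑ i ∈ Finset.range n, (1 : 𝕜) • e i)
    have h := c0_norm_apply_le y 0
    rw [hy, coord_sum (Finset.range n) (fun _ => 1) 0, if_pos h0, norm_one] at h
    simpa using h.trans hyn
  have h := hN n (by omega)
  rw [div_lt_div_iff₀ (by linarith) hB] at h
  nlinarith [le_abs_self B]

/-- By symmetry, k coordinates of modulus at least ε give 2‖z‖ ≥ ε‖e₀ + ⋯ + eₖ₋₁‖, which exceeds 2R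
once k is large. The bound is uniform on the ball. -/
lemma exists_card_le {e : SchauderBasis 𝕜 F} (hs : IsSymmetric 1 e) (he : DominatesC0 e)
    (hr : Tendsto (fun n : ℕ =>
      ‖∑ i ∈ Finset.range n, c0Unit 𝕜 i‖ / ‖∑ i ∈ Finset.range n, e i‖) atTop (𝓝 0))
    {ε : ℝ} (hε : 0 < ε) (R : ℝ) :
    ∃ N : ℕ, ∀ z : F, ‖z‖ ≤ R → ∀ A : Finset ℕ, (∀ i ∈ A, ε ≤ ‖e.coord i z‖) → A.card ≤ N := by
  obtain ⟨N, hN⟩ := exists_forall_lt_norm_sum_range he hr (2 * R / ε)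
  refine ⟨N, fun z hz A hA => ?_⟩
  by_contra hcon
  have h1 := hN A.card (by omega)
  have h2 := mul_norm_sum_basis_le hs.isUnconditional hε z A hA
  have h3 := hs.norm_sum_range_card_le A
  rw [div_lt_iff₀ hε] at h1
  nlinarith

/-- The coordinatewise limit of a sequence that is bounded in all norms `‖·‖_{mₙ}` by a common
constant is a null sequence. -/
lemma tendsto_zero_of_interpNorm_le {e : SchauderBasis 𝕜 F} (hs : IsSymmetric 1 e)
    (he : DominatesC0 e) (hr : Tendsto (fun n : ℕ =>
      ‖∑ i ∈ Finset.range n, c0Unit 𝕜 i‖ / ‖∑ i ∈ Finset.range n, e i‖) atTop (𝓝 0))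
    {m : ℕ → ℝ} (hm : ∀ n, 1 ≤ m n) (hm0 : Tendsto (fun n => 1 / m n) atTop (𝓝 0))
    {v : ℕ → C₀(ℕ, 𝕜)} {R : ℝ} (hv : ∀ n k, interpNorm e (m n) (v k) ≤ R) {a : ℕ → 𝕜}
    (ha : ∀ i, Tendsto (fun k => v k i) atTop (𝓝 (a i))) : Tendsto a atTop (𝓝 0) := by
  have hR : 0 ≤ R := (interpNorm_nonneg e (m 0) (v 0)).trans (hv 0 0)
  suffices hfin : ∀ δ : ℝ, 0 < δ → {i | δ < ‖a i‖}.Finite by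
    rw [← Nat.cofinite_eq_atTop, Metric.tendsto_nhds]
    intro δ hδ
    refine (hfin (δ / 2) (by positivity)).subset fun i hi => ?_
    rw [Set.mem_compl_iff, Set.mem_ofPred_eq, dist_zero_right, not_lt] at hi
    exact lt_of_lt_of_le (half_lt_self hδ) hi
  intro δ hδ
  -- With this n, the part y/mₙ contributes less than δ/2 to any coordinate. Where `v k` exceeds δ,
  -- the coordinate of z therefore has modulus at least δ/(2mₙ). The 1 in R + 1 is room for a
  -- splitting that only nearly attains the infimum.
  obtain ⟨n, hn⟩ := (hm0.eventually
    (gt_mem_nhds (show 0 < δ / (2 * (R + 1)) by positivity))).exists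
  have hmn : 0 < m n := by linarith [hm n]
  have hn' : 1 / m n * (R + 1) < δ / 2 := by
    rw [lt_div_iff₀ (by positivity)] at hn
    linarith
  obtain ⟨N, hN⟩ := exists_card_le hs he hr (show 0 < δ / (2 * m n) by positivity) (R + 1)
  by_contra hinf
  obtain ⟨A, hA, hAc⟩ := Set.Infinite.exists_subset_card_eq hinf (N + 1)
  have hev : ∀ᶠ k in atTop, ∀ i ∈ A, δ < ‖v k i‖ :=
    (Finset.eventually_all A).2 fun i hi => (ha i).norm.eventually (lt_mem_nhds (hA hi))
  obtain ⟨k, hk⟩ := hev.exists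
  obtain ⟨y, z, hyz, hlt⟩ := exists_lt_of_interpNorm_lt e (hm n)
    (show interpNorm e (m n) (v k) < R + 1 by linarith [hv n k])
  have hy : ‖y‖ ≤ R + 1 := (Real.le_sqrt_of_sq_le (by nlinarith [sq_nonneg ‖z‖])).trans hlt.le
  have hz : ‖z‖ ≤ R + 1 := (Real.le_sqrt_of_sq_le (by nlinarith [sq_nonneg ‖y‖])).trans hlt.le
  have := hN z hz A fun i hi => by
    have h1 := hk i hi
    rw [hyz i] at h1
    have h2 := norm_add_le (((1 / m n : ℝ) : 𝕜) * y i) ((m n : 𝕜) * e.coord i z)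
    rw [norm_mul, norm_mul, RCLike.norm_ofReal, RCLike.norm_ofReal, abs_of_pos hmn,
      abs_of_pos (one_div_pos.2 hmn)] at h2
    have h3 : 1 / m n * ‖y i‖ ≤ 1 / m n * (R + 1) :=
      mul_le_mul_of_nonneg_left ((c0_norm_apply_le y i).trans hy) (one_div_pos.2 hmn).le
    rw [div_le_iff₀ (by positivity)]
    linarith
  omega

/-- Truncating both parts of a splitting splits the truncation, and the basis projections of `F` are
contractive. -/
lemma interpNorm_c0Trunc_le {e : SchauderBasis 𝕜 F} (he : IsUnconditional 1 e) {m : ℝ}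
    (hm : 1 ≤ m) (N : ℕ) (x : C₀(ℕ, 𝕜)) : interpNorm e m (c0Trunc N x) ≤ interpNorm e m x := by
  refine le_of_forall_gt_imp_ge_of_dense fun r hr => ?_
  obtain ⟨y, z, hyz, hlt⟩ := exists_lt_of_interpNorm_lt e hm hr
  refine le_trans (interpNorm_le e (y := c0Trunc N y)
    (z := ∑ i ∈ Finset.range N, e.coord i z • e i) fun i => ?_) (le_trans ?_ hlt.le)
  · rw [c0Trunc_apply, c0Trunc_apply, coord_sum (Finset.range N) (fun i => e.coord i z) i, hyz i]
    simp only [Finset.mem_range]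
    split_ifs <;> simp
  · have h1 := c0Trunc_norm_le N y
    have h2 := norm_proj_le he (Finset.range N) z
    gcongr

/-- The splitting y = mx, z = 0 suffices. Hence each `‖·‖_m` is Lipschitz for the sup norm, with a
constant depending on m. -/
lemma interpNorm_le_mul_norm (e : SchauderBasis 𝕜 F) {m : ℝ} (hm : 1 ≤ m) (x : C₀(ℕ, 𝕜)) :
    interpNorm e m x ≤ m * ‖x‖ := by
  have hm0 : (m : 𝕜) ≠ 0 := by
    have : m ≠ 0 := by linarith
    exact_mod_cast this
  refine (interpNorm_le e (y := (m : 𝕜) • x) (z := 0) fun i => by simp [hm0]).trans (le_of_eq ?_)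
  rw [norm_zero, norm_smul, RCLike.norm_ofReal, abs_of_nonneg (by linarith)]
  simp only [ne_eq, OfNat.ofNat_ne_zero, not_false_eq_true, zero_pow, add_zero]
  exact Real.sqrt_sq (by positivity)

/-- The norms `‖·‖_m` are lower semicontinuous for coordinatewise convergence. -/
lemma eventually_interpNorm_le {e : SchauderBasis 𝕜 F} (he : IsUnconditional 1 e) {m : ℝ}
    (hm : 1 ≤ m) {v : ℕ → C₀(ℕ, 𝕜)} {x : C₀(ℕ, 𝕜)}
    (hc : ∀ i, Tendsto (fun k => v k i) atTop (𝓝 (x i))) {δ : ℝ} (hδ : 0 < δ) :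
    ∀ᶠ k in atTop, interpNorm e m x ≤ interpNorm e m (v k) + δ := by
  have hδ' : 0 < δ / (2 * m) := by positivity
  have key : ∀ u w : C₀(ℕ, 𝕜), dist u w < δ / (2 * m) →
      interpNorm e m w ≤ interpNorm e m u + δ / 2 := by
    intro u w h
    rw [dist_comm, dist_eq_norm, lt_div_iff₀ (by positivity)] at h
    have h1 := interpNorm_add_le e hm u (w - u)
    rw [add_sub_cancel] at h1
    linarith [interpNorm_le_mul_norm e hm (w - u)]
  -- For fixed N the truncations of `v k` converge in norm to that of x, since only finitely many
  -- coordinates matter. Each of the two approximations costs δ/2.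
  obtain ⟨N, hN⟩ := ((Metric.tendsto_nhds.1 (tendsto_c0Trunc x)) _ hδ').exists
  filter_upwards [(Metric.tendsto_nhds.1 (tendsto_c0Trunc_of_coord N hc)) _ hδ'] with k hk
  linarith [key _ _ hN, key _ _ hk, interpNorm_c0Trunc_le he hm N (v k)]

lemma interpNorm_sum_le (e : SchauderBasis 𝕜 F) {m : ℝ} (hm : 1 ≤ m) {ι : Type*} (s : Finset ι)
    {t : ι → ℝ} (ht : ∀ k, 0 ≤ t k) (x : ι → C₀(ℕ, 𝕜)) :
    interpNorm e m (∑ k ∈ s, (t k : 𝕜) • x k) ≤ ∑ k ∈ s, t k * interpNorm e m (x k) := by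
  refine (Finset.le_sum_of_subadditive (interpNorm e m) (interpNorm_zero e hm).le
    (interpNorm_add_le e hm) s _).trans (Finset.sum_le_sum fun k _ => ?_)
  refine (interpNorm_smul_le e hm _ _).trans (le_of_eq ?_)
  rw [RCLike.norm_ofReal, abs_of_nonneg (ht k)]

end Symmetric

/-! ### Bounds preserved by convex combinations -/

section ConvexCombinations

variable {𝕜 : Type*} [RCLike 𝕜] {V : Type*} [NormedAddCommGroup V] [NormedSpace 𝕜 V]

lemma norm_convexCombination_le {t : ℕ →₀ ℝ} (ht : ∀ k, 0 ≤ t k) (ht1 : ∑ k ∈ t.support, t k = 1)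
    {v : ℕ → V} {R : ℝ} (hv : ∀ k, ‖v k‖ ≤ R) : ‖∑ k ∈ t.support, (t k : 𝕜) • v k‖ ≤ R := by
  refine (norm_sum_le _ _).trans ?_
  calc ∑ k ∈ t.support, ‖(t k : 𝕜) • v k‖ ≤ ∑ k ∈ t.support, t k * R :=
        Finset.sum_le_sum fun k _ => by
          rw [norm_smul, RCLike.norm_ofReal, abs_of_nonneg (ht k)]
          exact mul_le_mul_of_nonneg_left (hv k) (ht k)
    _ = R := by rw [← Finset.sum_mul, ht1, one_mul]

lemma le_re_convexCombination {t : ℕ →₀ ℝ} (ht : ∀ k, 0 ≤ t k) (ht1 : ∑ k ∈ t.support, t k = 1)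
    {v : ℕ → V} {g : StrongDual 𝕜 V} {ε : ℝ} (hv : ∀ k, ε ≤ RCLike.re (g (v k))) :
    ε ≤ RCLike.re (g (∑ k ∈ t.support, (t k : 𝕜) • v k)) := by
  simp only [map_sum, map_smul, smul_eq_mul, RCLike.re_ofReal_mul]
  calc ε = ∑ k ∈ t.support, t k * ε := by rw [← Finset.sum_mul, ht1, one_mul]
    _ ≤ _ := Finset.sum_le_sum fun k _ => mul_le_mul_of_nonneg_left (hv k) (ht k)

end ConvexCombinations

/-! ### Bounded sequences in `Y` and their coordinatewise limits -/

section Space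

variable {𝕜 : Type*} [RCLike 𝕜] {F : Type*} [NormedAddCommGroup F] [NormedSpace 𝕜 F]
  {X : Type*} [NormedAddCommGroup X] [NormedSpace 𝕜 X] [CompleteSpace X]

lemma le_norm_seriesSum {f : SchauderBasis 𝕜 X} (hf : IsUnconditional 1 f)
    (hf1 : ∀ n, ‖f n‖ = 1) {a : ℕ → ℝ} (ha : ∀ n, 0 ≤ a n)
    (hc : Converges (fun n => (a n : 𝕜) • f n)) (n : ℕ) :
    a n ≤ ‖seriesSum (fun n => (a n : 𝕜) • f n)‖ := by
  have h := norm_seriesSum_mono hf (a := fun k => if k ∈ ({n} : Finset ℕ) then a k else 0)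
    (fun k => by split_ifs <;> simp [ha]) (fun k => by split_ifs <;> simp [ha]) hc
  have h1 := hasSum_finset f {n} (fun k => (a k : 𝕜))
  have h2 : (fun k => ((if k ∈ ({n} : Finset ℕ) then a k else 0 : ℝ) : 𝕜) • f k) =
      fun k => (if k ∈ ({n} : Finset ℕ) then (a k : 𝕜) else 0) • f k := by
    funext k
    split_ifs <;> simp
  rw [h2, seriesSum, h1.tsum_eq, Finset.sum_singleton, norm_smul, hf1, mul_one,
    RCLike.norm_ofReal, abs_of_nonneg (ha n)] at h
  exact h

variable {e : SchauderBasis 𝕜 F} {f : SchauderBasis 𝕜 X} {m : ℕ → ℝ}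
  {he : DominatesC0 e} {hf : IsUnconditional 1 f} {hm : ∀ n, 1 ≤ m n}

lemma DavisSpace.interpNorm_le_norm (hf1 : ∀ n, ‖f n‖ = 1) (y : DavisSpace e f m he hf hm)
    (n : ℕ) : interpNorm e (m n) (DavisSpace.toC0 e f m he hf hm y) ≤ ‖y‖ :=
  le_norm_seriesSum hf hf1 (fun n => interpNorm_nonneg e (m n) _)
    (DavisSpace.converges e f m he hf hm y) n

lemma DavisSpace.norm_toC0_le (hf1 : ∀ n, ‖f n‖ = 1) (y : DavisSpace e f m he hf hm) :
    ‖DavisSpace.toC0 e f m he hf hm y‖ ≤ 2 * m 0 * ‖y‖ := by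
  refine (norm_le_interpNorm he (hm 0) _).trans ?_
  have := hm 0
  exact mul_le_mul_of_nonneg_left (DavisSpace.interpNorm_le_norm hf1 y 0) (by linarith)

/-- The inclusion of `Y` in `c₀` as a bounded operator. -/
def DavisSpace.toC0L (hf1 : ∀ n, ‖f n‖ = 1) : DavisSpace e f m he hf hm →L[𝕜] C₀(ℕ, 𝕜) :=
  LinearMap.mkContinuous (DavisSpace.toC0 e f m he hf hm) (2 * m 0) (DavisSpace.norm_toC0_le hf1)

lemma DavisSpace.toC0L_apply (hf1 : ∀ n, ‖f n‖ = 1) (y : DavisSpace e f m he hf hm) :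
    DavisSpace.toC0L hf1 y = DavisSpace.toC0 e f m he hf hm y :=
  rfl

/-- The norm of a combination in `Y` with nonnegative coefficients is dominated by that of the same
combination in `X`. -/
lemma DavisSpace.norm_sum_le {ι : Type*} (s : Finset ι) {t : ι → ℝ} (ht : ∀ k, 0 ≤ t k)
    (y : ι → DavisSpace e f m he hf hm) :
    ‖∑ k ∈ s, (t k : 𝕜) • y k‖ ≤ ‖∑ k ∈ s, (t k : 𝕜) •
      seriesSum (davisTerm e f m (DavisSpace.toC0 e f m he hf hm (y k)))‖ := by
  have h1 : HasSum (fun n => ∑ k ∈ s, (t k : 𝕜) •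
      davisTerm e f m (DavisSpace.toC0 e f m he hf hm (y k)) n) (∑ k ∈ s, (t k : 𝕜) •
      seriesSum (davisTerm e f m (DavisSpace.toC0 e f m he hf hm (y k))))
      (SummationFilter.conditional ℕ) :=
    hasSum_sum fun k _ => (DavisSpace.converges e f m he hf hm (y k)).hasSum.const_smul _
  have h2 : (fun n => ∑ k ∈ s, (t k : 𝕜) •
      davisTerm e f m (DavisSpace.toC0 e f m he hf hm (y k)) n) = fun n =>
      ((∑ k ∈ s, t k * interpNorm e (m n) (DavisSpace.toC0 e f m he hf hm (y k)) : ℝ) : 𝕜) •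
        f n := by
    funext n
    push_cast
    rw [Finset.sum_smul]
    exact Finset.sum_congr rfl fun k _ => by rw [davisTerm, smul_smul]
  rw [h2] at h1
  -- Convexity of each `‖·‖_{mₙ}` compares the coefficients, and `1`-unconditionality passes the
  -- comparison to the norm of `X`.
  have h3 := norm_seriesSum_mono hf
    (fun n => interpNorm_nonneg e (m n) (∑ k ∈ s, (t k : 𝕜) •
      DavisSpace.toC0 e f m he hf hm (y k)))
    (fun n => interpNorm_sum_le e (hm n) s ht fun k => DavisSpace.toC0 e f m he hf hm (y k))
    h1.summable
  rw [seriesSum, seriesSum, h1.tsum_eq] at h3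
  rw [DavisSpace.norm_def, map_sum]
  simp only [map_smul]
  exact h3

/-- If `X` is reflexive, then bounded sequences in `Y` that are null in `c₀` are not bounded away
from zero by a functional. -/
lemma DavisSpace.exists_re_lt (hX : IsReflexive 𝕜 X) {u : ℕ → DavisSpace e f m he hf hm} {R : ℝ}
    (hu : ∀ k, ‖u k‖ ≤ R)
    (hu0 : Tendsto (fun k => ‖DavisSpace.toC0 e f m he hf hm (u k)‖) atTop (𝓝 0))
    (g : StrongDual 𝕜 (DavisSpace e f m he hf hm)) {ε : ℝ} (hε : 0 < ε) :
    ∃ k, RCLike.re (g (u k)) < ε := by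
  by_contra! hcon
  have hw : ∀ h : StrongDual 𝕜 X, Tendsto (fun k =>
      h (seriesSum (davisTerm e f m (DavisSpace.toC0 e f m he hf hm (u k))))) atTop (𝓝 0) := by
    refine hX.tendsto_zero_of_coord f hu fun n => ?_
    have h1 : Tendsto (fun k => interpNorm e (m n) (DavisSpace.toC0 e f m he hf hm (u k))) atTop
        (𝓝 0) := by
      refine squeeze_zero (fun k => interpNorm_nonneg e _ _)
        (fun k => interpNorm_le_mul_norm e (hm n) _) ?_
      simpa using hu0.const_mul (m n)
    have h2 := (RCLike.continuous_ofReal (K := 𝕜)).tendsto 0 |>.comp h1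
    rw [RCLike.ofReal_zero] at h2
    exact h2.congr fun k =>
      (coord_eq_of_converges (DavisSpace.converges e f m he hf hm (u k)) n).symm
  -- A combination of norm below this δ has Re g < ε, even when g = 0.
  have hδ : 0 < ε / (‖g‖ + 1) := by positivity
  obtain ⟨t, ht, ht1, hlt⟩ := exists_convexCombination_norm_lt hw hδ
  have h1 := le_re_convexCombination ht ht1 hcon
  have h2 := (DavisSpace.norm_sum_le t.support ht u).trans_lt hlt
  have h3 := (RCLike.re_le_norm _).trans (g.le_opNorm (∑ k ∈ t.support, (t k : 𝕜) • u k))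
  rw [lt_div_iff₀ (by positivity)] at h2
  nlinarith [norm_nonneg (∑ k ∈ t.support, (t k : 𝕜) • u k), norm_nonneg g]

/-- If `X` is reflexive, then bounded coordinatewise null sequences in `Y` are weakly null. -/
lemma DavisSpace.tendsto_zero_of_coord (hX : IsReflexive 𝕜 X) (hf1 : ∀ n, ‖f n‖ = 1)
    {y : ℕ → DavisSpace e f m he hf hm} {R : ℝ} (hy : ∀ k, ‖y k‖ ≤ R)
    (hc : ∀ i, Tendsto (fun k => DavisSpace.toC0 e f m he hf hm (y k) i) atTop (𝓝 0))
    (g : StrongDual 𝕜 (DavisSpace e f m he hf hm)) :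
    Tendsto (fun k => g (y k)) atTop (𝓝 0) := by
  rw [Metric.tendsto_nhds]
  intro ε hε
  by_contra hcon
  obtain ⟨ns, hns, hge⟩ := extraction_of_frequently_atTop (not_eventually.1 hcon)
  simp only [dist_zero_right, not_lt] at hge
  -- Rotating each term makes g real and at least ε on it, a condition stable under convex
  -- combinations.
  choose c hc1 hcg using fun j => RCLike.exists_norm_eq_mul_self (g (y (ns j)))
  set v : ℕ → DavisSpace e f m he hf hm := fun j => c j • y (ns j) with hv
  have hvR : ∀ j, ‖v j‖ ≤ R := fun j => by
    rw [hv, norm_smul, hc1, one_mul]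
    exact hy _
  have hvg : ∀ j, ε ≤ RCLike.re (g (v j)) := fun j => by
    rw [hv, map_smul, smul_eq_mul, ← hcg, RCLike.ofReal_re]
    exact hge j
  have hv0 : ∀ h : StrongDual 𝕜 C₀(ℕ, 𝕜), Tendsto (fun j => h (DavisSpace.toC0L hf1 (v j))) atTop
      (𝓝 0) := by
    refine c0_tendsto_zero_of_coord (R := ‖DavisSpace.toC0L hf1‖ * R)
      (fun j => ContinuousLinearMap.le_opNorm_of_le _ (hvR j)) fun i => ?_
    rw [tendsto_zero_iff_norm_tendsto_zero]
    have h0 := ((hc i).comp hns.tendsto_atTop).norm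
    rw [norm_zero] at h0
    refine h0.congr fun j => ?_
    rw [hv, map_smul, ZeroAtInftyContinuousMap.smul_apply, norm_smul, hc1, one_mul]
    rfl
  choose t ht ht1 hlt using fun p : ℕ =>
    exists_convexCombination_norm_lt hv0 (δ := 1 / ((p : ℝ) + 1)) (by positivity)
  obtain ⟨p, hp⟩ := DavisSpace.exists_re_lt hX
    (u := fun p => ∑ k ∈ (t p).support, ((t p k : ℝ) : 𝕜) • v k)
    (fun p => norm_convexCombination_le (ht p) (ht1 p) hvR)
    (squeeze_zero (fun p => norm_nonneg _) (fun p => by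
      refine le_trans (le_of_eq ?_) (hlt p).le
      simp only [← DavisSpace.toC0L_apply hf1, map_sum, map_smul])
      tendsto_one_div_add_atTop_nhds_zero_nat) g hε
  exact hp.not_ge (le_re_convexCombination (ht p) (ht1 p) hvg)

/-- If `X` is reflexive, then every element of the bidual of `Y` acts on the coordinate functionals
like an element of `Y`. -/
lemma DavisSpace.exists_forall_coord_eq (hX : IsReflexive 𝕜 X) (hf1 : ∀ n, ‖f n‖ = 1)
    (hs : IsSymmetric 1 e) (hr : Tendsto (fun n : ℕ =>
      ‖∑ i ∈ Finset.range n, c0Unit 𝕜 i‖ / ‖∑ i ∈ Finset.range n, e i‖) atTop (𝓝 0))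
    (hm0 : Tendsto (fun n => 1 / m n) atTop (𝓝 0))
    (φ : StrongDual 𝕜 (StrongDual 𝕜 (DavisSpace e f m he hf hm))) :
    ∃ x : DavisSpace e f m he hf hm, ∀ i, DavisSpace.toC0 e f m he hf hm x i =
      φ ((c0Coord 𝕜 i).comp (DavisSpace.toC0L hf1)) := by
  obtain ⟨y, hy, hlim⟩ := exists_seq_tendsto_bidual φ
    fun i => (c0Coord 𝕜 i).comp (DavisSpace.toC0L hf1)
  have hlim' : ∀ i, Tendsto (fun k => DavisSpace.toC0 e f m he hf hm (y k) i) atTop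
      (𝓝 (φ ((c0Coord 𝕜 i).comp (DavisSpace.toC0L hf1)))) := hlim
  have ha := tendsto_zero_of_interpNorm_le hs he hr hm hm0
    (fun n k => (DavisSpace.interpNorm_le_norm hf1 (y k) n).trans (hy k)) hlim'
  set x : C₀(ℕ, 𝕜) := c0OfTendsto _ ha with hx
  have hconv : Converges (davisTerm e f m x) := by
    -- ‖φ‖ + 1 bounds the approximating sequence. The other 1 absorbs N errors of size 1/(N+1) on
    -- normalized basis vectors.
    refine hX.converges_of_bounded f (R := ‖φ‖ + 2) fun N => ?_
    have hN : (0 : ℝ) < 1 / ((N : ℝ) + 1) := by positivity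
    obtain ⟨k, hk⟩ := ((Finset.eventually_all (Finset.range N)).2 fun n _ =>
      eventually_interpNorm_le (x := x) hs.isUnconditional (hm n) hlim' hN).exists
    set w := DavisSpace.toC0 e f m he hf hm (y k) with hw
    have h1 : ‖∑ n ∈ Finset.range N, (interpNorm e (m n) x : 𝕜) • f n‖ ≤
        ‖∑ n ∈ Finset.range N, ((interpNorm e (m n) w + 1 / ((N : ℝ) + 1) : ℝ) : 𝕜) • f n‖ := by
      have h := norm_sum_mono hf (Finset.range N)
        -- `norm_sum_mono` asks for the comparison at every index, but it is known only for n < N.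
        (fun n => if n ∈ Finset.range N then interpNorm e (m n) x else 0)
        (fun n => interpNorm e (m n) w + 1 / ((N : ℝ) + 1))
        (fun n => by split_ifs; exacts [interpNorm_nonneg e _ _, le_rfl])
        (fun n => by
          split_ifs with h
          · exact hk n h
          · exact add_nonneg (interpNorm_nonneg e _ _) hN.le)
      refine le_trans (le_of_eq ?_) h
      congr 1
      exact Finset.sum_congr rfl fun n hn => by rw [if_pos hn]
    have h2 : ∑ n ∈ Finset.range N, ((interpNorm e (m n) w + 1 / ((N : ℝ) + 1) : ℝ) : 𝕜) • f n =
        ∑ n ∈ Finset.range N, (interpNorm e (m n) w : 𝕜) • f n +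
          ∑ n ∈ Finset.range N, ((1 / ((N : ℝ) + 1) : ℝ) : 𝕜) • f n := by
      rw [← Finset.sum_add_distrib]
      exact Finset.sum_congr rfl fun n _ => by rw [RCLike.ofReal_add, add_smul]
    have h3 : ‖∑ n ∈ Finset.range N, (interpNorm e (m n) w : 𝕜) • f n‖ ≤ ‖φ‖ + 1 := by
      refine le_trans ?_ (hy k)
      have h := norm_proj_le hf (Finset.range N) (seriesSum (davisTerm e f m w))
      refine le_trans (le_of_eq ?_) h
      congr 1
      exact Finset.sum_congr rfl fun n _ => by
        rw [show f.coord n (seriesSum (davisTerm e f m w)) = _ from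
          coord_eq_of_converges (DavisSpace.converges e f m he hf hm (y k)) n]
    have h4 : ‖∑ n ∈ Finset.range N, ((1 / ((N : ℝ) + 1) : ℝ) : 𝕜) • f n‖ ≤ 1 := by
      refine (_root_.norm_sum_le _ _).trans ?_
      simp only [norm_smul, hf1, RCLike.norm_ofReal, mul_one, abs_of_pos hN, Finset.sum_const,
        Finset.card_range, nsmul_eq_mul]
      rw [mul_one_div]
      exact div_le_one_of_le₀ (by linarith) (by positivity)
    rw [h2] at h1
    linarith [norm_add_le (∑ n ∈ Finset.range N, (interpNorm e (m n) w : 𝕜) • f n)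
      (∑ n ∈ Finset.range N, ((1 / ((N : ℝ) + 1) : ℝ) : 𝕜) • f n)]
  exact ⟨⟨x, hconv⟩, fun i => rfl⟩

end Space

end Davis

end

/-! ### Reflexivity of `Y` -/

theorem mainTheorem9 {𝕜 : Type*} [RCLike 𝕜]
    {F : Type*} [NormedAddCommGroup F] [NormedSpace 𝕜 F] [CompleteSpace F]
    {X : Type*} [NormedAddCommGroup X] [NormedSpace 𝕜 X] [CompleteSpace X]
    (e : SchauderBasis 𝕜 F) (he_sym : Davis.IsSymmetric 1 e)
    (he_dom : Davis.DominatesC0 e)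
    (he_ratio : Tendsto (fun n : ℕ =>
      ‖∑ i ∈ Finset.range n, Davis.c0Unit 𝕜 i‖ / ‖∑ i ∈ Finset.range n, e i‖) atTop (𝓝 0))
    (f : SchauderBasis 𝕜 X) (hf_norm : ∀ n, ‖f n‖ = 1) (hf_unc : Davis.IsUnconditional 1 f)
    (m : ℕ → ℝ) (hm_mono : StrictMono m) (hm_one : ∀ n, 1 ≤ m n)
    (hm_sum : Summable (fun n => 1 / m n))
    (hX : Davis.IsReflexive 𝕜 X) :
    Davis.IsReflexive 𝕜 (Davis.DavisSpace e f m he_dom hf_unc hm_one) := by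
  intro φ
  obtain ⟨x, hx⟩ := Davis.DavisSpace.exists_forall_coord_eq hX hf_norm he_sym he_ratio
    hm_sum.tendsto_atTop_zero φ
  refine ⟨x, ContinuousLinearMap.ext fun g => ?_⟩
  rw [NormedSpace.dual_def]
  -- A new sequence, depending on g: index 0 carries g and index i + 1 the i-th coordinate, so the
  -- same vectors approximate φ on both.
  obtain ⟨y, hy, hlim⟩ := Davis.exists_seq_tendsto_bidual φ fun i =>
    Nat.casesOn i g fun i => (Davis.c0Coord 𝕜 i).comp (Davis.DavisSpace.toC0L hf_norm)
  have h := Davis.DavisSpace.tendsto_zero_of_coord hX hf_norm (y := fun k => y k - x)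
    (R := ‖φ‖ + 1 + ‖x‖) (fun k => (norm_sub_le _ _).trans (by linarith [hy k]))
    (fun i => by
      have h1 := (hlim (i + 1)).sub_const (Davis.DavisSpace.toC0 e f m he_dom hf_unc hm_one x i)
      rw [hx i] at h1
      simp only [sub_self] at h1
      rw [← hx i] at h1
      exact h1.congr fun k => by simp only [map_sub]; rfl) g
  refine tendsto_nhds_unique ?_ (hlim 0)
  simpa using h.add_const (g x)
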